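/- Let $b>1$ and $\nu\ge\frac12$, and let $J_\nu$ and $Y_\nu$ denote the Bessel functions of order $\nu$ of the first and second kinds. The positive zeros of the function $$\rho\mapsto J_\nu(\rho)Y_\nu(\rho b)-J_\nu(\rho b)Y_\nu(\rho)\qquad(\rho>0)$$ can be arranged in a strictly increasing infinite sequence $(\rho_{\nu,m})_{m\ge1}$, and $$\rho_{\nu,m+1}-\rho_{\nu,m}>\frac{\pi}{2b-1}\qquad(m\ge2).$$ -/

import Mathlib

/-- The Bessel function of the first kind of real order `ν`,
`J_ν(x) = ∑ₖ (-1)ᵏ / (k! Γ(ν + k + 1)) (x/2)^(ν + 2k)`, for real `x > 0`.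
(`Real.Gamma` vanishes at its poles, so that there the quotient is `0`, in agreement with
the usual convention `1 / Γ = 0` at the poles.) -/
noncomputable def besselJ (ν x : ℝ) : ℝ :=
  (x / 2) ^ ν *
    ∑' k : ℕ, (-1) ^ k / ((k.factorial : ℝ) * Real.Gamma (ν + k + 1)) * (x / 2) ^ (2 * k)

/-- The quotient `(J_ν(x) cos νπ - J_{-ν}(x)) / sin νπ`, meaningful for non-integral `ν`. -/
noncomputable def besselYQuot (ν x : ℝ) : ℝ :=
  (besselJ ν x * Real.cos (ν * Real.pi) - besselJ (-ν) x) / Real.sin (ν * Real.pi)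

/-- The Bessel function of the second kind of real order `ν`, for real `x > 0`:
`Y_ν(x) = (J_ν(x) cos νπ - J_{-ν}(x)) / sin νπ` if `ν` is not an integer, and
`Y_n(x) = lim_{μ → n, μ ≠ n} Y_μ(x)` if `ν = n` is an integer (that is, if `sin νπ = 0`). -/
noncomputable def besselY (ν x : ℝ) : ℝ :=
  if Real.sin (ν * Real.pi) = 0 then
    Filter.limUnder (nhdsWithin ν {ν}ᶜ) (fun μ : ℝ => besselYQuot μ x)
  else besselYQuot ν x

/-- The cross product
`U_ν(ρ, t) = J_ν(ρt) Y_ν(ρb) - J_ν(ρb) Y_ν(ρt)` of Bessel functions. -/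
noncomputable def besselCross (b ν ρ t : ℝ) : ℝ :=
  besselJ ν (ρ * t) * besselY ν (ρ * b) - besselJ ν (ρ * b) * besselY ν (ρ * t)

/-- `ρ 1 < ρ 2 < ρ 3 < ⋯` is the infinite sequence of all the positive zeros of
`r ↦ U_ν(r, 1)`, arranged in increasing order (the value `ρ 0` is irrelevant). -/
def IsPositiveZeroSeq (b ν : ℝ) (ρ : ℕ → ℝ) : Prop :=
  StrictMonoOn ρ (Set.Ici 1) ∧
    ρ '' Set.Ici 1 = {r : ℝ | 0 < r ∧ besselCross b ν r 1 = 0}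

/-!
The functions `√x J_ν(x)` and `√x Y_ν(x)` are independent solutions of `u'' + q u = 0` on `(0, ∞)`,
where `q(x) = 1 - a / x²` and `a = ν² - 1/4 ≥ 0`. Up to a nonzero factor the cross product is
`u(r) v(rb) - u(rb) v(r)` for any pair of solutions `u, v` with Wronskian `1`
(`exists_isUnitPair_cross`), so that the pair can be chosen to suit the argument. Put
`w = u² + v²` and `(u, v) = √w (cos θ, sin θ)`; then `θ' = 1 / w`, and the zeros are the points
where the phase difference `Δ(r) = θ(rb) - θ(r)` is a multiple of `π`.

* Separation. Given two zeros `r₁ < r₂`, take the pair with initial values `(1, 0)` and `(0, 1)`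
  at `r₂ b`. Because `q` increases and `q ≤ 1`, an energy argument gives `w ≥ 1` on `(0, r₂ b]`
  (`IsUnitPair.one_le_modulus`), whence `Δ'(r) = b / w(rb) - 1 / w(r) ≤ b`. At a zero, a
  Pohozaev-type identity for the solution vanishing at `r` and at `rb` gives `Δ' > 0`
  (`IsUnitPair.phase_diff_deriv_pos`), so `Δ` crosses multiples of `π` only upwards and gains at
  least `π` between `r₁` and `r₂`. Hence `r₂ - r₁ ≥ π / b > π / (2 b - 1)`, for every pair of zeros.
* Infinitude. For a fixed pair, `w` is bounded near infinity, so `Δ(r)` grows at least linearly and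
  takes all large multiples of `π` (`IsUnitPair.exists_cross_eq_zero`). A separated unbounded set of
  positive reals is the range of an increasing sequence.

On the Bessel side, the differential equation comes from the recurrence of the power series
coefficients. For integral order `n`, the limit defining `Y_n` is a combination of the derivatives
of `J_μ` in the order `μ` at `±n`; these satisfy inhomogeneous equations whose right-hand sides
cancel because `J_{-n} = (-1)ⁿ J_n`. Independence is read off at the origin: `x^ν J_ν(x) → 0`,
whereas `x^ν Y_ν(x)` has a nonzero limit (`exists_tendsto_besselY`).
-/

/-! ### Solutions of the Liouville normal form -/

/-- `u`, with derivative `u'`, solves the Liouville normal form `u'' + (1 - a / x²) u = 0` of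
Bessel's equation on `(0, ∞)`; for order `ν` the parameter is `a = ν² - 1/4`. -/
def IsLiouvilleSol (a : ℝ) (u u' : ℝ → ℝ) : Prop :=
  ∀ x, 0 < x → HasDerivAt u (u' x) x ∧ HasDerivAt u' (-((1 - a / x ^ 2) * u x)) x

/-- A pair of solutions of `u'' + (1 - a / x²) u = 0` on `(0, ∞)` with Wronskian `1`. -/
structure IsUnitPair (a : ℝ) (u u' v v' : ℝ → ℝ) : Prop where
  left : IsLiouvilleSol a u u'
  right : IsLiouvilleSol a v v'
  wronskian : ∀ x, 0 < x → u x * v' x - u' x * v x = 1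

theorem hasDerivAt_potential (a : ℝ) {x : ℝ} (hx : 0 < x) :
    HasDerivAt (fun x : ℝ => 1 - a / x ^ 2) (2 * a / x ^ 3) x := by
  refine HasDerivAt.congr_deriv
    ((((hasDerivAt_pow 2 x).inv (pow_ne_zero 2 hx.ne')).const_mul a).const_sub 1) ?_
  have := hx.ne'
  norm_num
  field_simp

namespace IsLiouvilleSol

variable {a : ℝ} {u u' v v' : ℝ → ℝ}

theorem linear_comb (hu : IsLiouvilleSol a u u') (hv : IsLiouvilleSol a v v') (p q : ℝ) :
    IsLiouvilleSol a (fun x => p * u x + q * v x) (fun x => p * u' x + q * v' x) := by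
  intro x hx
  refine ⟨((hu x hx).1.const_mul p).add ((hv x hx).1.const_mul q), ?_⟩
  refine HasDerivAt.congr_deriv (((hu x hx).2.const_mul p).add ((hv x hx).2.const_mul q)) ?_
  ring

theorem wronskian_eq (hu : IsLiouvilleSol a u u') (hv : IsLiouvilleSol a v v') {x y : ℝ}
    (hx : 0 < x) (hy : 0 < y) :
    u x * v' x - u' x * v x = u y * v' y - u' y * v y := by
  have hd : ∀ z ∈ Set.Ioi (0 : ℝ), HasDerivAt (fun z => u z * v' z - u' z * v z) 0 z := by
    intro z hz
    refine HasDerivAt.congr_deriv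
      (((hu z hz).1.mul (hv z hz).2).sub ((hu z hz).2.mul (hv z hz).1)) ?_
    ring
  exact isOpen_Ioi.is_const_of_deriv_eq_zero isPreconnected_Ioi
    (fun z hz => (hd z hz).differentiableAt.differentiableWithinAt)
    (fun z hz => (hd z hz).deriv) hx hy

/-- A Pohozaev-type identity: `x u'² + x (1 - a / x²) u² - u u'` has derivative `2 u²`. -/
theorem hasDerivAt_pohozaev (hu : IsLiouvilleSol a u u') {x : ℝ} (hx : 0 < x) :
    HasDerivAt (fun x => x * u' x ^ 2 + (x - a / x) * u x ^ 2 - u x * u' x) (2 * u x ^ 2) x := by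
  have h1 := (hu x hx).1
  have h2 := (hu x hx).2
  have hi : HasDerivAt (fun x : ℝ => x - a / x) (1 + a / x ^ 2) x := by
    refine HasDerivAt.congr_deriv ((hasDerivAt_id' x).sub ((hasDerivAt_inv hx.ne').const_mul a)) ?_
    ring
  refine HasDerivAt.congr_deriv
    ((((hasDerivAt_id' x).mul (h2.pow 2)).add (hi.mul (h1.pow 2))).sub (h1.mul h2)) ?_
  have := hx.ne'
  simp only [Pi.pow_apply]
  field_simp
  ring

/-- If a solution vanishes at `x < y` and has slope `1` at `x`, then `y u'(y)² > x`. -/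
theorem lt_mul_deriv_sq (hu : IsLiouvilleSol a u u') {x y : ℝ} (hx : 0 < x) (hxy : x < y)
    (hux : u x = 0) (hux' : u' x = 1) (huy : u y = 0) : x < y * u' y ^ 2 := by
  set K : ℝ → ℝ := fun x => x * u' x ^ 2 + (x - a / x) * u x ^ 2 - u x * u' x with hK
  have hd : ∀ z, 0 < z → HasDerivAt K (2 * u z ^ 2) z := fun z hz => hu.hasDerivAt_pohozaev hz
  have hmono : MonotoneOn K (Set.Icc x y) := by
    refine monotoneOn_of_deriv_nonneg (convex_Icc x y)
      (fun z hz => (hd z (hx.trans_le hz.1)).continuousAt.continuousWithinAt)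
      (fun z hz => ?_) (fun z hz => ?_)
    · rw [interior_Icc] at hz
      exact (hd z (hx.trans hz.1)).differentiableAt.differentiableWithinAt
    · rw [interior_Icc] at hz
      rw [(hd z (hx.trans hz.1)).deriv]
      positivity
  have hKx : K x = x := by simp [hK, hux, hux']
  have hKy : K y = y * u' y ^ 2 := by simp [hK, huy]
  by_contra hlt
  push Not at hlt
  -- Otherwise `K` is constant on `[x, y]`, so that `u` vanishes on `(x, y)`, and then `K = 0`.
  have hconst : ∀ z ∈ Set.Icc x y, K z = x := fun z hz => le_antisymm
    ((hmono hz ⟨hxy.le, le_rfl⟩ hz.2).trans (hKy.le.trans hlt))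
    (hKx.symm.le.trans (hmono ⟨le_rfl, hxy.le⟩ hz hz.1))
  have hu0 : ∀ z ∈ Set.Ioo x y, u z = 0 := by
    intro z hz
    have h1 := hd z (hx.trans hz.1)
    have h2 : HasDerivAt K 0 z := by
      refine (hasDerivAt_const z x).congr_of_eventuallyEq ?_
      filter_upwards [Icc_mem_nhds hz.1 hz.2] with t ht using hconst t ht
    have := h1.unique h2
    simpa using this
  obtain ⟨z, hz⟩ := exists_between hxy
  have hz0 := hx.trans hz.1
  have hu'z : u' z = 0 := by
    refine (hu z hz0).1.unique ((hasDerivAt_const z (0 : ℝ)).congr_of_eventuallyEq ?_)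
    filter_upwards [Ioo_mem_nhds hz.1 hz.2] with t ht using hu0 t ht
  have := hconst z ⟨hz.1.le, hz.2.le⟩
  simp only [hK, hu0 z hz, hu'z] at this
  norm_num at this
  exact hx.ne this

end IsLiouvilleSol

/-! ### Modulus and phase of a pair of solutions -/

namespace IsUnitPair

variable {a : ℝ} {u u' v v' : ℝ → ℝ}

/-- Two solutions with nonzero Wronskian can be recombined into a unit pair with
prescribed initial values `(1, 0)`, `(0, 1)` at `X`; the antisymmetric cross product only changes
by a nonzero factor. -/
theorem exists_normalized (hu : IsLiouvilleSol a u u') (hv : IsLiouvilleSol a v v')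
    {X : ℝ} (hX : 0 < X) (hW : u X * v' X - u' X * v X ≠ 0) :
    ∃ U U' V V' : ℝ → ℝ, IsUnitPair a U U' V V' ∧
      U X = 1 ∧ U' X = 0 ∧ V X = 0 ∧ V' X = 1 ∧
      ∀ x y, u x * v y - u y * v x = 0 ↔ U x * V y - U y * V x = 0 := by
  set W := u X * v' X - u' X * v X with hWdef
  clear_value W
  have h1 := hu.linear_comb hv (v' X / W) (-u' X / W)
  have h2 := hu.linear_comb hv (-v X / W) (u X / W)
  have e1 : v' X / W * u X + -u' X / W * v X = 1 := by
    field_simp; rw [hWdef]; ring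
  have e2 : v' X / W * u' X + -u' X / W * v' X = 0 := by ring
  have e3 : -v X / W * u X + u X / W * v X = 0 := by ring
  have e4 : -v X / W * u' X + u X / W * v' X = 1 := by
    field_simp; rw [hWdef]; ring
  refine ⟨_, _, _, _, ⟨h1, h2, fun x hx => ?_⟩, e1, e2, e3, e4, fun x y => ?_⟩
  · rw [h1.wronskian_eq h2 hx hX, e1, e2, e3, e4]; ring
  · have : (v' X / W * u x + -u' X / W * v x) * (-v X / W * u y + u X / W * v y) -
        (v' X / W * u y + -u' X / W * v y) * (-v X / W * u x + u X / W * v x) =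
        (u x * v y - u y * v x) / W := by
      field_simp
      rw [hWdef]
      ring
    rw [this, div_eq_zero_iff, or_iff_left hW]

theorem hasDerivAt_phase_diff {θ : ℝ → ℝ}
    (hθ : ∀ x, 0 < x → HasDerivAt θ (1 / (u x ^ 2 + v x ^ 2)) x) {b : ℝ} (hb : 0 < b)
    {r : ℝ} (hr : 0 < r) :
    HasDerivAt (fun r => θ (r * b) - θ r)
      (1 / (u (r * b) ^ 2 + v (r * b) ^ 2) * b - 1 / (u r ^ 2 + v r ^ 2)) r := by
  have h1 : HasDerivAt (fun r : ℝ => r * b) b r := by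
    simpa using (hasDerivAt_id' r).mul_const b
  exact (HasDerivAt.comp (h := fun r => r * b) r (hθ (r * b) (mul_pos hr hb)) h1).sub (hθ r hr)

/-- Cauchy-Schwarz for the Wronskian. -/
theorem one_le_mul (h : IsUnitPair a u u' v v') {x : ℝ} (hx : 0 < x) :
    1 ≤ (u x ^ 2 + v x ^ 2) * (u' x ^ 2 + v' x ^ 2) := by
  nlinarith [h.wronskian x hx, sq_nonneg (u x * u' x + v x * v' x)]

theorem modulus_pos (h : IsUnitPair a u u' v v') {x : ℝ} (hx : 0 < x) : 0 < u x ^ 2 + v x ^ 2 := by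
  by_contra hc
  have h0 : u x ^ 2 + v x ^ 2 = 0 := le_antisymm (not_lt.1 hc) (by positivity)
  have := h.one_le_mul hx
  rw [h0] at this
  norm_num at this

theorem hasDerivAt_modulus (h : IsUnitPair a u u' v v') {x : ℝ} (hx : 0 < x) :
    HasDerivAt (fun x => u x ^ 2 + v x ^ 2) (2 * (u x * u' x + v x * v' x)) x := by
  refine HasDerivAt.congr_deriv (((h.left x hx).1.pow 2).add ((h.right x hx).1.pow 2)) ?_
  push_cast; ring

/-- The energy `u'² + v'² + (1 - a / x²) (u² + v²)` has derivative `(2 a / x³) (u² + v²)`. -/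
theorem hasDerivAt_energy (h : IsUnitPair a u u' v v') {x : ℝ} (hx : 0 < x) :
    HasDerivAt (fun x => u' x ^ 2 + v' x ^ 2 + (1 - a / x ^ 2) * (u x ^ 2 + v x ^ 2))
      (2 * a / x ^ 3 * (u x ^ 2 + v x ^ 2)) x := by
  have hq := hasDerivAt_potential a hx
  refine HasDerivAt.congr_deriv ((((h.left x hx).2.pow 2).add ((h.right x hx).2.pow 2)).add
    (hq.mul (h.hasDerivAt_modulus hx))) ?_
  push_cast; ring

/-- For the pair normalised at `X`, the squared modulus `u² + v²` is at least `1` on `(0, X]`.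
At the last point where it takes a value `c < 1`, the quantity `u'² + v'² + q (u² + v² - c)`
with `q = 1 - a / x²` would be at least `1 / c`; it increases up to `X`, where it equals
`1 + q (1 - c) < 1 / c`. -/
theorem one_le_modulus (h : IsUnitPair a u u' v v') (ha : 0 ≤ a) {X : ℝ} (hX : 0 < X)
    (hu : u X = 1) (hu' : u' X = 0) (hv : v X = 0) (hv' : v' X = 1) {x : ℝ} (hx : 0 < x)
    (hxX : x ≤ X) : 1 ≤ u x ^ 2 + v x ^ 2 := by
  set w : ℝ → ℝ := fun x => u x ^ 2 + v x ^ 2 with hw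
  by_contra! hlt
  change w x < 1 at hlt
  have hwX : w X = 1 := by simp [hw, hu, hv]
  obtain ⟨c, hc, hc1⟩ := exists_between hlt
  have hc0 : 0 < c := (h.modulus_pos hx).trans hc
  have hcont : ∀ y, 0 < y → ContinuousOn w (Set.Icc y X) := fun y hy z hz =>
    (h.hasDerivAt_modulus (hy.trans_le hz.1)).continuousAt.continuousWithinAt
  have hS : IsCompact (Set.Icc x X ∩ w ⁻¹' {c}) :=
    isCompact_Icc.of_isClosed_subset
      ((hcont x hx).preimage_isClosed_of_isClosed isClosed_Icc isClosed_singleton)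
      Set.inter_subset_left
  have hne : (Set.Icc x X ∩ w ⁻¹' {c}).Nonempty := by
    obtain ⟨z, hz, hzc⟩ := intermediate_value_Icc hxX (hcont x hx) ⟨hc.le, hc1.le.trans hwX.ge⟩
    exact ⟨z, hz, hzc⟩
  obtain ⟨x₁, ⟨hx₁, hx₁c⟩, hmax⟩ := hS.exists_isGreatest hne
  have hx₁c : w x₁ = c := hx₁c
  have hx₁0 : 0 < x₁ := hx.trans_le hx₁.1
  have hge : ∀ y ∈ Set.Icc x₁ X, c ≤ w y := by
    intro y hy
    by_contra! hyc
    obtain ⟨z, hz, hzc⟩ := intermediate_value_Icc hy.2 (hcont y (hx₁0.trans_le hy.1))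
      ⟨hyc.le, hc1.le.trans hwX.ge⟩
    have : z ≤ x₁ := hmax ⟨⟨hx₁.1.trans (hy.1.trans hz.1), hz.2⟩, hzc⟩
    have hyx : y = x₁ := le_antisymm (hz.1.trans this) hy.1
    rw [hyx, hx₁c] at hyc
    exact lt_irrefl _ hyc
  set G : ℝ → ℝ := fun x => u' x ^ 2 + v' x ^ 2 + (1 - a / x ^ 2) * w x - (1 - a / x ^ 2) * c
    with hG
  have hGd : ∀ y, 0 < y → HasDerivAt G (2 * a / y ^ 3 * (w y - c)) y := by
    intro y hy
    have hq := hasDerivAt_potential a hy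
    refine HasDerivAt.congr_deriv ((h.hasDerivAt_energy hy).sub (hq.mul_const c)) ?_
    ring
  have hmono : MonotoneOn G (Set.Icc x₁ X) := by
    refine monotoneOn_of_deriv_nonneg (convex_Icc x₁ X)
      (fun z hz => (hGd z (hx₁0.trans_le hz.1)).continuousAt.continuousWithinAt)
      (fun z hz => ?_) (fun z hz => ?_)
    · rw [interior_Icc] at hz
      exact (hGd z (hx₁0.trans hz.1)).differentiableAt.differentiableWithinAt
    · rw [interior_Icc] at hz
      have hz0 := hx₁0.trans hz.1
      rw [(hGd z hz0).deriv]
      have := hge z ⟨hz.1.le, hz.2.le⟩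
      exact mul_nonneg (by positivity) (by linarith)
  have hle := hmono ⟨le_rfl, hx₁.2⟩ ⟨hx₁.2, le_rfl⟩ hx₁.2
  have hGX : G X = 1 + (1 - a / X ^ 2) * (1 - c) := by
    simp only [hG, hwX, hu', hv']; ring
  have hG1 : G x₁ = u' x₁ ^ 2 + v' x₁ ^ 2 := by
    simp only [hG, hx₁c]; ring
  have h1 : 1 ≤ c * (u' x₁ ^ 2 + v' x₁ ^ 2) := hx₁c ▸ h.one_le_mul hx₁0
  rw [hGX, hG1] at hle
  have hq1 : 0 ≤ a / X ^ 2 := by positivity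
  nlinarith [mul_le_mul_of_nonneg_left hle hc0.le, mul_pos (sub_pos.2 hc1) (sub_pos.2 hc1),
    mul_nonneg (mul_nonneg hc0.le (sub_pos.2 hc1).le) hq1]

/-- The phase: an antiderivative `θ` of `1 / (u² + v²)` with
`(u, v) = √(u² + v²) (cos θ, sin θ)`. -/
theorem exists_phase (h : IsUnitPair a u u' v v') {X : ℝ} (hX : 0 < X) (hu : u X = 1)
    (hv : v X = 0) :
    ∃ θ : ℝ → ℝ, (∀ x, 0 < x → HasDerivAt θ (1 / (u x ^ 2 + v x ^ 2)) x) ∧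
      ∀ x, 0 < x → u x = √(u x ^ 2 + v x ^ 2) * Real.cos (θ x) ∧
        v x = √(u x ^ 2 + v x ^ 2) * Real.sin (θ x) := by
  have hcont : ContinuousOn (fun x => 1 / (u x ^ 2 + v x ^ 2)) (Set.Ioi 0) := fun x hx =>
    (continuousAt_const.div (h.hasDerivAt_modulus hx).continuousAt
      (h.modulus_pos hx).ne').continuousWithinAt
  have hθ : ∀ x, 0 < x → HasDerivAt (fun x => ∫ t in X..x, 1 / (u t ^ 2 + v t ^ 2))
      (1 / (u x ^ 2 + v x ^ 2)) x := by
    intro x hx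
    refine intervalIntegral.integral_hasDerivAt_right
      (hcont.mono fun t ht => ?_).intervalIntegrable
      (hcont.stronglyMeasurableAtFilter isOpen_Ioi x hx)
      (hcont.continuousAt (isOpen_Ioi.mem_nhds hx))
    exact (lt_min hX hx).trans_le ht.1
  refine ⟨_, hθ, fun x hx => ?_⟩
  set θ : ℝ → ℝ := fun x => ∫ t in X..x, 1 / (u t ^ 2 + v t ^ 2) with hθdef
  have hθX : θ X = 0 := by simp [hθdef]
  set A : ℝ → ℝ := fun x => (u x * Real.cos (θ x) + v x * Real.sin (θ x)) / √(u x ^ 2 + v x ^ 2)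
  set B : ℝ → ℝ := fun x => (v x * Real.cos (θ x) - u x * Real.sin (θ x)) / √(u x ^ 2 + v x ^ 2)
  have hdA : ∀ y ∈ Set.Ioi (0 : ℝ), HasDerivAt A 0 y := by
    intro y hy
    have hw := h.modulus_pos hy
    have hr := Real.sqrt_pos.2 hw
    have hs := Real.sq_sqrt hw.le
    refine HasDerivAt.congr_deriv
      (((((h.left y hy).1.mul (hθ y hy).cos).add
        ((h.right y hy).1.mul (hθ y hy).sin)).div
      ((h.hasDerivAt_modulus hy).sqrt hw.ne') hr.ne')) ?_
    simp only [Pi.add_apply, Pi.mul_apply]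
    have hW := h.wronskian y hy
    set r := √(u y ^ 2 + v y ^ 2)
    rw [← hs]
    field_simp
    rw [hs]
    linear_combination (u y * Real.sin (θ y) - v y * Real.cos (θ y)) * hW
  have hdB : ∀ y ∈ Set.Ioi (0 : ℝ), HasDerivAt B 0 y := by
    intro y hy
    have hw := h.modulus_pos hy
    have hr := Real.sqrt_pos.2 hw
    have hs := Real.sq_sqrt hw.le
    refine HasDerivAt.congr_deriv
      ((((h.right y hy).1.mul (hθ y hy).cos).sub ((h.left y hy).1.mul (hθ y hy).sin)).div
      ((h.hasDerivAt_modulus hy).sqrt hw.ne') hr.ne') ?_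
    simp only [Pi.sub_apply, Pi.mul_apply]
    have hW := h.wronskian y hy
    set r := √(u y ^ 2 + v y ^ 2)
    rw [← hs]
    field_simp
    rw [hs]
    linear_combination (u y * Real.cos (θ y) + v y * Real.sin (θ y)) * hW
  have hA : A x = 1 := by
    have : A x = A X := isOpen_Ioi.is_const_of_deriv_eq_zero isPreconnected_Ioi
      (fun z hz => (hdA z hz).differentiableAt.differentiableWithinAt)
      (fun z hz => (hdA z hz).deriv) hx hX
    rw [this]
    simp [A, hθX, hu, hv]
  have hB : B x = 0 := by
    have : B x = B X := isOpen_Ioi.is_const_of_deriv_eq_zero isPreconnected_Ioi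
      (fun z hz => (hdB z hz).differentiableAt.differentiableWithinAt)
      (fun z hz => (hdB z hz).deriv) hx hX
    rw [this]
    simp [B, hθX, hu, hv]
  have hr := Real.sqrt_pos.2 (h.modulus_pos hx)
  rw [div_eq_iff hr.ne', one_mul] at hA
  rw [div_eq_iff hr.ne', zero_mul] at hB
  constructor
  · rw [← hA]
    linear_combination -Real.sin (θ x) * hB - u x * Real.sin_sq_add_cos_sq (θ x)
  · rw [← hA]
    linear_combination Real.cos (θ x) * hB - v x * Real.sin_sq_add_cos_sq (θ x)

/-- The cross product `u(x) v(y) - u(y) v(x)` vanishes exactly when the phases of `x` and `y`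
differ by a multiple of `π`. -/
theorem cross_eq_zero_iff (h : IsUnitPair a u u' v v') {θ : ℝ → ℝ}
    (hθ : ∀ x, 0 < x → u x = √(u x ^ 2 + v x ^ 2) * Real.cos (θ x) ∧
      v x = √(u x ^ 2 + v x ^ 2) * Real.sin (θ x)) {x y : ℝ} (hx : 0 < x) (hy : 0 < y) :
    u x * v y - u y * v x = 0 ↔ ∃ k : ℤ, k * Real.pi = θ y - θ x := by
  have hrx := Real.sqrt_pos.2 (h.modulus_pos hx)
  have hry := Real.sqrt_pos.2 (h.modulus_pos hy)
  have : u x * v y - u y * v x =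
      √(u x ^ 2 + v x ^ 2) * √(u y ^ 2 + v y ^ 2) * Real.sin (θ y - θ x) := by
    rw [Real.sin_sub]
    obtain ⟨h1, h2⟩ := hθ x hx
    obtain ⟨h3, h4⟩ := hθ y hy
    set r := √(u x ^ 2 + v x ^ 2)
    set s := √(u y ^ 2 + v y ^ 2)
    rw [h1, h2, h3, h4]
    ring
  rw [this, mul_eq_zero, or_iff_right (mul_pos hrx hry).ne', Real.sin_eq_zero_iff]

/-- At a zero `r` of `r ↦ u(r) v(rb) - u(rb) v(r)` the phase difference `θ(rb) - θ(r)`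
has positive derivative. -/
theorem phase_diff_deriv_pos (h : IsUnitPair a u u' v v') {b : ℝ} (hb : 1 < b) {r : ℝ} (hr : 0 < r)
    (hz : u r * v (r * b) - u (r * b) * v r = 0) :
    0 < 1 / (u (r * b) ^ 2 + v (r * b) ^ 2) * b - 1 / (u r ^ 2 + v r ^ 2) := by
  have hlt : r < r * b := lt_mul_of_one_lt_right hr hb
  have hrb := hr.trans hlt
  have hW := h.wronskian r hr
  have hK := (h.left.linear_comb h.right (-v r) (u r)).lt_mul_deriv_sq hr hlt (by ring)
    (by linarith) (by linarith)
  have hWb := h.wronskian _ hrb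
  have hw := h.modulus_pos hr
  have hwb := h.modulus_pos hrb
  set A := u (r * b)
  set B := v (r * b)
  set A' := u' (r * b)
  set B' := v' (r * b)
  have e1 : A * (-v r * A' + u r * B') = u r := by
    linear_combination u r * hWb + A' * hz
  have e2 : B * (-v r * A' + u r * B') = v r := by
    linear_combination v r * hWb + B' * hz
  have e : (A ^ 2 + B ^ 2) * (-v r * A' + u r * B') ^ 2 = u r ^ 2 + v r ^ 2 := by
    rw [add_mul, ← mul_pow, ← mul_pow, e1, e2]
  have hK' : 1 < b * (-v r * A' + u r * B') ^ 2 := by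
    have : r * 1 < r * (b * (-v r * A' + u r * B') ^ 2) := by linarith
    exact lt_of_mul_lt_mul_left this hr.le
  rw [sub_pos, one_div_mul_eq_div, div_lt_div_iff₀ hw hwb]
  calc 1 * (A ^ 2 + B ^ 2) < (b * (-v r * A' + u r * B') ^ 2) * (A ^ 2 + B ^ 2) := by gcongr
    _ = b * (u r ^ 2 + v r ^ 2) := by rw [← e]; ring

/-- For the pair normalised at `r₂ b`, any two zeros `r₁ < r₂` of the cross product are at least
`π / b` apart: the phase difference has slope at most `b` and, since it crosses each multiple
of `π` upwards, it gains at least `π`. -/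
theorem pi_le_of_cross_eq_zero (h : IsUnitPair a u u' v v') (ha : 0 ≤ a) {b : ℝ} (hb : 1 < b)
    {r₁ r₂ : ℝ} (hr₁ : 0 < r₁)
    (hr : r₁ < r₂)
    (hu : u (r₂ * b) = 1) (hu' : u' (r₂ * b) = 0) (hv : v (r₂ * b) = 0) (hv' : v' (r₂ * b) = 1)
    (hz₁ : u r₁ * v (r₁ * b) - u (r₁ * b) * v r₁ = 0)
    (hz₂ : u r₂ * v (r₂ * b) - u (r₂ * b) * v r₂ = 0) : Real.pi ≤ b * (r₂ - r₁) := by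
  have hb0 := one_pos.trans hb
  have hr₂ := hr₁.trans hr
  obtain ⟨θ, hθ, hpol⟩ := h.exists_phase (mul_pos hr₂ hb0) hu hv
  set Δ : ℝ → ℝ := fun r => θ (r * b) - θ r with hΔ
  have hd : ∀ r, 0 < r → HasDerivAt Δ
      (1 / (u (r * b) ^ 2 + v (r * b) ^ 2) * b - 1 / (u r ^ 2 + v r ^ 2)) r :=
    fun r hr => hasDerivAt_phase_diff hθ hb0 hr
  have hcross : ∀ r, 0 < r → (u r * v (r * b) - u (r * b) * v r = 0 ↔
      ∃ k : ℤ, k * Real.pi = Δ r) := fun r hr => h.cross_eq_zero_iff hpol hr (mul_pos hr hb0)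
  have hcont : ContinuousOn Δ (Set.Icc r₁ r₂) := fun r hr =>
    (hd r (hr₁.trans_le hr.1)).continuousAt.continuousWithinAt
  obtain ⟨k₁, hk₁⟩ := (hcross r₁ hr₁).1 hz₁
  obtain ⟨k₂, hk₂⟩ := (hcross r₂ hr₂).1 hz₂
  have hge : ∀ r ∈ Set.Icc r₁ r₂, Δ r₁ ≤ Δ r := by
    refine image_le_of_deriv_right_lt_deriv_boundary' (f := fun _ => Δ r₁) (f' := fun _ => 0)
      continuousOn_const (fun r _ => hasDerivWithinAt_const _ _ _) le_rfl hcont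
      (fun r hr => (hd r (hr₁.trans_le hr.1)).hasDerivWithinAt) (fun r hr he => ?_)
    have hr0 := hr₁.trans_le hr.1
    exact h.phase_diff_deriv_pos hb hr0 ((hcross r hr0).2 ⟨k₁, hk₁.trans he⟩)
  have hne : Δ r₂ ≠ Δ r₁ := by
    intro he
    have hpos := h.phase_diff_deriv_pos hb hr₂ hz₂
    have hmin : ∀ᶠ r in nhdsWithin r₂ (Set.Iio r₂), slope Δ r₂ r ≤ 0 := by
      filter_upwards [Ioo_mem_nhdsLT hr] with r hr
      rw [slope_def_field]
      exact div_nonpos_of_nonneg_of_nonpos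
        (by linarith [hge r ⟨hr.1.le, hr.2.le⟩]) (by linarith [hr.2])
    have hlim := (hasDerivAt_iff_tendsto_slope.1 (hd r₂ hr₂)).mono_left
      (nhdsWithin_mono r₂ (s := Set.Iio r₂) (fun x hx => ne_of_lt hx))
    exact absurd (le_of_tendsto hlim hmin) (not_le.2 hpos)
  have hlt : Δ r₁ < Δ r₂ := lt_of_le_of_ne (hge r₂ ⟨hr.le, le_rfl⟩) hne.symm
  have hk : k₁ + 1 ≤ k₂ := by
    rw [← hk₁, ← hk₂, mul_lt_mul_iff_left₀ Real.pi_pos] at hlt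
    exact_mod_cast hlt
  have hgain : Real.pi ≤ Δ r₂ - Δ r₁ := by
    rw [← hk₁, ← hk₂]
    have : (k₁ : ℝ) + 1 ≤ k₂ := by exact_mod_cast hk
    nlinarith [Real.pi_pos]
  refine hgain.trans ((convex_Icc r₁ r₂).image_sub_le_mul_sub_of_deriv_le hcont
    (fun r hr => ?_) (fun r hr => ?_) r₁ ⟨le_rfl, hr.le⟩ r₂ ⟨hr.le, le_rfl⟩ hr.le)
  · rw [interior_Icc] at hr
    exact (hd r (hr₁.trans hr.1)).differentiableAt.differentiableWithinAt
  · rw [interior_Icc] at hr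
    have hr0 := hr₁.trans hr.1
    rw [(hd r hr0).deriv]
    have h1 := h.one_le_modulus ha (mul_pos hr₂ hb0) hu hu' hv hv' (mul_pos hr0 hb0)
      (mul_le_mul_of_nonneg_right hr.2.le hb0.le)
    have h2 : 1 / (u (r * b) ^ 2 + v (r * b) ^ 2) ≤ 1 := by
      rw [div_le_one (one_pos.trans_le h1)]; exact h1
    have h3 := one_div_pos.2 (h.modulus_pos hr0)
    nlinarith

/-- The squared modulus is bounded near infinity, because the energy times `exp (2 a / x²)` is
nonincreasing where `1 - a / x² ≥ 1/2`. -/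
theorem exists_modulus_le (h : IsUnitPair a u u' v v') (ha : 0 ≤ a) :
    ∃ R C : ℝ, 0 < R ∧ ∀ x, R ≤ x → u x ^ 2 + v x ^ 2 ≤ C := by
  set E : ℝ → ℝ := fun x => u' x ^ 2 + v' x ^ 2 + (1 - a / x ^ 2) * (u x ^ 2 + v x ^ 2) with hE
  set R : ℝ := 2 * a + 1 with hR
  have hR0 : 0 < R := by positivity
  have hq : ∀ x, R ≤ x → 1 / 2 ≤ 1 - a / x ^ 2 := by
    intro x hx
    have hx1 : 1 ≤ x := by linarith
    have : a / x ^ 2 ≤ 1 / 2 := by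
      rw [div_le_div_iff₀ (by positivity) two_pos]
      nlinarith
    linarith
  have hwE : ∀ x, R ≤ x → u x ^ 2 + v x ^ 2 ≤ 2 * E x := by
    intro x hx
    have := mul_le_mul_of_nonneg_right (hq x hx) (by positivity : 0 ≤ u x ^ 2 + v x ^ 2)
    simp only [hE]
    nlinarith [sq_nonneg (u' x), sq_nonneg (v' x)]
  set Φ : ℝ → ℝ := fun x => E x * Real.exp (2 * (1 - (1 - a / x ^ 2))) with hΦ
  have hd : ∀ x, 0 < x → HasDerivAt Φ (2 * a / x ^ 3 * (u x ^ 2 + v x ^ 2 - 2 * E x) *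
      Real.exp (2 * (1 - (1 - a / x ^ 2)))) x := by
    intro x hx
    refine HasDerivAt.congr_deriv ((h.hasDerivAt_energy hx).mul
      (((hasDerivAt_potential a hx).const_sub 1).const_mul 2).exp) ?_
    simp only [hE]
    ring
  have hanti : AntitoneOn Φ (Set.Ici R) := by
    refine antitoneOn_of_deriv_nonpos (convex_Ici R)
      (fun z hz => (hd z (hR0.trans_le hz)).continuousAt.continuousWithinAt)
      (fun z hz => ?_) (fun z hz => ?_)
    · rw [interior_Ici] at hz
      exact (hd z (hR0.trans hz)).differentiableAt.differentiableWithinAt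
    · rw [interior_Ici] at hz
      have hz0 : 0 < z := hR0.trans hz
      rw [(hd z hz0).deriv]
      exact mul_nonpos_of_nonpos_of_nonneg (mul_nonpos_of_nonneg_of_nonpos (by positivity)
        (by linarith [hwE z (le_of_lt hz)])) (Real.exp_pos _).le
  refine ⟨R, 2 * Φ R, hR0, fun x hx => (hwE x hx).trans ?_⟩
  have hE0 : 0 ≤ E x := by
    have := hwE x hx
    have h2 : 0 ≤ u x ^ 2 + v x ^ 2 := by positivity
    linarith
  have hexp : 1 ≤ Real.exp (2 * (1 - (1 - a / x ^ 2))) := by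
    rw [Real.one_le_exp_iff]
    have : 0 ≤ a / x ^ 2 := by positivity
    linarith
  have h3 : E x ≤ Φ x := le_mul_of_one_le_right hE0 hexp
  linarith [hanti Set.self_mem_Ici hx hx]

/-- The zeros of the cross product are unbounded, since the phase difference tends to infinity. -/
theorem exists_cross_eq_zero (h : IsUnitPair a u u' v v') (ha : 0 ≤ a) (hu : u 1 = 1) (hv : v 1 = 0)
    {b : ℝ} (hb : 1 < b)
    (N : ℝ) : ∃ r, 0 < r ∧ N ≤ r ∧ u r * v (r * b) - u (r * b) * v r = 0 := by
  have hb0 := one_pos.trans hb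
  obtain ⟨θ, hθ, hpol⟩ := h.exists_phase one_pos hu hv
  obtain ⟨R, C, hR, hC⟩ := h.exists_modulus_le ha
  have hC0 : 0 < C := (h.modulus_pos hR).trans_le (hC R le_rfl)
  set Δ : ℝ → ℝ := fun r => θ (r * b) - θ r with hΔ
  have hd : ∀ r, 0 < r → HasDerivAt Δ
      (1 / (u (r * b) ^ 2 + v (r * b) ^ 2) * b - 1 / (u r ^ 2 + v r ^ 2)) r :=
    fun r hr => hasDerivAt_phase_diff hθ hb0 hr
  have hlow : ∀ r, R ≤ r → (b - 1) / C * r ≤ Δ r := by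
    intro r hr
    have hr0 := hR.trans_le hr
    have hle : r ≤ r * b := le_mul_of_one_le_right hr0.le hb.le
    have := (convex_Icc r (r * b)).mul_sub_le_image_sub_of_le_deriv (f := θ) (C := 1 / C)
      (fun x hx => (hθ x (hr0.trans_le hx.1)).continuousAt.continuousWithinAt)
      (fun x hx => by
        rw [interior_Icc] at hx
        exact (hθ x (hr0.trans hx.1)).differentiableAt.differentiableWithinAt)
      (fun x hx => by
        rw [interior_Icc] at hx
        have hx0 := hr0.trans hx.1
        rw [(hθ x hx0).deriv]
        exact one_div_le_one_div_of_le (h.modulus_pos hx0) (hC x (hr.trans hx.1.le)))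
      r ⟨le_rfl, hle⟩ (r * b) ⟨hle, le_rfl⟩ hle
    calc (b - 1) / C * r = 1 / C * (r * b - r) := by ring
      _ ≤ Δ r := this
  set S := max R N
  have hS0 : 0 < S := hR.trans_le (le_max_left _ _)
  obtain ⟨k, hk⟩ := exists_nat_ge (Δ S / Real.pi)
  rw [div_le_iff₀ Real.pi_pos] at hk
  have hbC : 0 < (b - 1) / C := div_pos (sub_pos.2 hb) hC0
  set T := max S (k * Real.pi / ((b - 1) / C))
  have hT : k * Real.pi ≤ Δ T := by
    refine le_trans ?_ (hlow T ((le_max_left _ _).trans (le_max_left _ _)))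
    have : k * Real.pi / ((b - 1) / C) ≤ T := le_max_right _ _
    rw [div_le_iff₀ hbC] at this
    linarith
  obtain ⟨r, hr, hrk⟩ := intermediate_value_Icc (le_max_left S (k * Real.pi / ((b - 1) / C)))
    (fun x hx => (hd x (hS0.trans_le hx.1)).continuousAt.continuousWithinAt) ⟨hk, hT⟩
  have hr0 := hS0.trans_le hr.1
  exact ⟨r, hr0, (le_max_right _ _).trans hr.1,
    (h.cross_eq_zero_iff hpol hr0 (mul_pos hr0 hb0)).2 ⟨k, by push_cast; exact hrk.symm⟩⟩

end IsUnitPair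

/-! ### Enumeration of a separated set -/

/-- An unbounded set of positive reals whose points are at least `δ > 0` apart can be
enumerated increasingly. -/
theorem exists_strictMono_range_of_separated {Z : Set ℝ} {δ : ℝ} (hδ : 0 < δ)
    (hpos : ∀ z ∈ Z, 0 < z) (hsep : ∀ y ∈ Z, ∀ z ∈ Z, y < z → δ ≤ z - y)
    (hunb : ∀ N : ℝ, ∃ z ∈ Z, N ≤ z) : ∃ f : ℕ → ℝ, StrictMono f ∧ Set.range f = Z := by
  classical
  set fl : ℝ → ℕ := fun z => ⌊z / δ⌋₊ with hfldef
  have hfl : StrictMonoOn fl Z := by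
    intro y hy z hz hyz
    have h1 : y / δ + 1 ≤ z / δ := by
      rw [← sub_nonneg, show z / δ - (y / δ + 1) = (z - y - δ) / δ by field_simp; ring]
      exact div_nonneg (by linarith [hsep y hy z hz hyz]) hδ.le
    have h2 : 0 ≤ y / δ := (div_pos (hpos y hy) hδ).le
    calc fl y < ⌊y / δ⌋₊ + 1 := Nat.lt_succ_self _
      _ = ⌊y / δ + 1⌋₊ := (Nat.floor_add_one h2).symm
      _ ≤ fl z := Nat.floor_mono h1
  have hinf : (fl '' Z).Infinite := by
    refine Set.infinite_of_forall_exists_gt fun n => ?_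
    obtain ⟨z, hz, hzn⟩ := hunb (((n + 1 : ℕ) : ℝ) * δ)
    exact ⟨fl z, ⟨z, hz, rfl⟩, Nat.le_floor ((le_div_iff₀ hδ).2 hzn)⟩
  have := hinf.to_subtype
  set e := Nat.Subtype.orderIsoOfNat (fl '' Z)
  have hmem : ∀ n, Function.invFunOn fl Z (e n) ∈ Z := fun n => Function.invFunOn_mem (e n).2
  have heq : ∀ n, fl (Function.invFunOn fl Z (e n)) = e n := fun n => Function.invFunOn_eq (e n).2
  refine ⟨fun n => Function.invFunOn fl Z (e n), fun m n hmn => ?_, Set.Subset.antisymm ?_ ?_⟩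
  · rw [← hfl.lt_iff_lt (hmem m) (hmem n), heq, heq]
    exact e.strictMono hmn
  · rintro _ ⟨n, rfl⟩
    exact hmem n
  · intro z hz
    obtain ⟨n, hn⟩ := e.surjective ⟨fl z, z, hz, rfl⟩
    exact ⟨n, hfl.injOn (hmem n) hz (by rw [heq, hn])⟩

/-! ### Everywhere convergent power series -/

/-- Coefficients of an everywhere convergent real power series. -/
def IsEntireCoeff (c : ℕ → ℝ) : Prop :=
  ∀ R : ℝ, 0 ≤ R → Summable fun k => |c k| * R ^ k

/-- The sum of the power series with coefficients `c`. -/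
noncomputable def powerSum (c : ℕ → ℝ) (z : ℝ) : ℝ := ∑' k, c k * z ^ k

/-- The coefficients of the differentiated power series. -/
def derivCoeff (c : ℕ → ℝ) (k : ℕ) : ℝ := (k + 1) * c (k + 1)

namespace IsEntireCoeff

variable {c : ℕ → ℝ}

theorem summable (hc : IsEntireCoeff c) (z : ℝ) : Summable fun k => c k * z ^ k := by
  refine Summable.of_norm ?_
  simpa [abs_mul, abs_pow] using hc |z| (abs_nonneg z)

theorem of_abs_le {A B : ℝ} (h : ∀ k, |c k| ≤ A * B ^ k / k.factorial) :
    IsEntireCoeff c := by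
  intro R hR
  refine Summable.of_nonneg_of_le (fun k => by positivity) (fun k => ?_)
    ((Real.summable_pow_div_factorial (B * R)).mul_left A)
  calc |c k| * R ^ k ≤ A * B ^ k / k.factorial * R ^ k := by gcongr; exact h k
    _ = A * ((B * R) ^ k / k.factorial) := by rw [mul_pow]; ring

theorem derivCoeff (hc : IsEntireCoeff c) : IsEntireCoeff (derivCoeff c) := by
  intro R hR
  have h := (summable_nat_add_iff 1).2 (hc (2 * (R + 1)) (by positivity))
  refine Summable.of_nonneg_of_le (fun k => by positivity) (fun k => ?_) h
  have h1 : ((k : ℝ) + 1) ≤ 2 ^ (k + 1) := by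
    exact_mod_cast (Nat.lt_two_pow_self (n := k + 1)).le
  have h2 : R ^ k ≤ (R + 1) ^ (k + 1) :=
    (pow_le_pow_left₀ hR (by linarith) k).trans (pow_le_pow_right₀ (by linarith) (Nat.le_succ k))
  have h3 : |(k : ℝ) + 1| = k + 1 := abs_of_pos (by positivity)
  calc |(k + 1) * c (k + 1)| * R ^ k = |c (k + 1)| * ((k + 1) * R ^ k) := by
        rw [abs_mul, h3]; ring
    _ ≤ |c (k + 1)| * (2 ^ (k + 1) * (R + 1) ^ (k + 1)) := by gcongr
    _ = |c (k + 1)| * (2 * (R + 1)) ^ (k + 1) := by rw [mul_pow]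

theorem hasDerivAt (hc : IsEntireCoeff c) (z : ℝ) :
    HasDerivAt (powerSum c) (powerSum (_root_.derivCoeff c) z) z := by
  set R := |z| + 1
  have hu : Summable fun k : ℕ => (k : ℝ) * |c k| * R ^ (k - 1) := by
    refine (summable_nat_add_iff 1).1 ((hc.derivCoeff R (by positivity)).congr fun k => ?_)
    have h3 : |(k : ℝ) + 1| = k + 1 := abs_of_pos (by positivity)
    simp only [_root_.derivCoeff, abs_mul, h3, Nat.add_sub_cancel]
    push_cast; ring
  have hz : z ∈ Metric.ball (0 : ℝ) R := by simp [R]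
  have h := hasDerivAt_tsum_of_isPreconnected (g := fun k z => c k * z ^ k)
    (g' := fun k z => c k * (k * z ^ (k - 1))) hu Metric.isOpen_ball
    (convex_ball (0 : ℝ) R).isPreconnected
    (fun k y _ => (hasDerivAt_pow k y).const_mul (c k)) (fun k y hy => ?_) hz
    (hc.summable z) hz
  · refine h.congr_deriv ?_
    have hs : Summable fun k : ℕ => c k * (k * z ^ (k - 1)) := by
      refine (summable_nat_add_iff 1).1 ((hc.derivCoeff.summable z).congr fun k => ?_)
      simp only [_root_.derivCoeff, Nat.add_sub_cancel]
      push_cast; ring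
    rw [hs.tsum_eq_zero_add, powerSum]
    simp only [_root_.derivCoeff, Nat.add_sub_cancel]
    simp only [Nat.cast_zero, zero_mul, mul_zero, zero_add]
    exact tsum_congr fun k => by push_cast; ring
  · have hy' : |y| ≤ R := by simpa using (Metric.mem_ball.1 hy).le
    rw [Real.norm_eq_abs, abs_mul, abs_mul, abs_pow, Nat.abs_cast]
    calc |c k| * (k * |y| ^ (k - 1)) ≤ |c k| * (k * R ^ (k - 1)) := by gcongr
      _ = _ := by ring

theorem continuous (hc : IsEntireCoeff c) : Continuous (powerSum c) :=
  continuous_iff_continuousAt.2 fun z => (hc.hasDerivAt z).continuousAt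

end IsEntireCoeff

theorem powerSum_zero (c : ℕ → ℝ) : powerSum c 0 = c 0 := by
  rw [powerSum, tsum_eq_single 0 (fun k hk => by simp [hk])]
  simp

/-- The recurrence for the coefficients of `z C'' + (μ + 1) C' + C + E' = 0`, where `E` enters
when a logarithmic solution is sought. -/
theorem powerSum_ode {μ : ℝ} {c e : ℕ → ℝ} (hc : IsEntireCoeff c) (he : IsEntireCoeff e)
    (h : ∀ k : ℕ, (k + 1) * (μ + k + 1) * c (k + 1) + c k + (k + 1) * e (k + 1) = 0) (z : ℝ) :
    z * powerSum (derivCoeff (derivCoeff c)) z + (μ + 1) * powerSum (derivCoeff c) z +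
      powerSum c z + powerSum (derivCoeff e) z = 0 := by
  have h0 := hc.derivCoeff.derivCoeff.summable z
  have h1 := hc.derivCoeff.summable z
  have h2 := hc.summable z
  have h3 := he.derivCoeff.summable z
  have hshift : Summable fun k : ℕ => k * derivCoeff c k * z ^ k := by
    refine (summable_nat_add_iff 1).1 ((h0.mul_left z).congr fun k => ?_)
    simp only [derivCoeff]
    push_cast; ring
  have e0 : z * powerSum (derivCoeff (derivCoeff c)) z = ∑' k : ℕ, k * derivCoeff c k * z ^ k := by
    rw [powerSum, ← tsum_mul_left, hshift.tsum_eq_zero_add]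
    simp only [Nat.cast_zero, zero_mul, zero_add]
    exact tsum_congr fun k => by simp only [derivCoeff]; push_cast; ring
  rw [e0]
  simp only [powerSum]
  rw [← tsum_mul_left, ← hshift.tsum_add (h1.mul_left _),
    ← (hshift.add (h1.mul_left _)).tsum_add h2,
    ← ((hshift.add (h1.mul_left _)).add h2).tsum_add h3]
  rw [← tsum_zero (α := ℝ) (β := ℕ)]
  refine tsum_congr fun k => ?_
  simp only [derivCoeff]
  linear_combination z ^ k * h k

/-! ### The reciprocal Gamma function -/

/-- The reciprocal Gamma function on the real line, an everywhere smooth function. -/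
noncomputable def rGamma (s : ℝ) : ℝ := (Real.Gamma s)⁻¹

theorem contDiff_rGamma : ContDiff ℝ 1 rGamma := by
  have h := (Complex.differentiable_one_div_Gamma.contDiff (n := 1)).real_of_complex
  have he : rGamma = fun x : ℝ => ((Complex.Gamma x)⁻¹).re := by
    funext s
    rw [Complex.Gamma_ofReal, ← Complex.ofReal_inv, Complex.ofReal_re, rGamma]
  rw [he]
  exact h

theorem hasDerivAt_rGamma (s : ℝ) : HasDerivAt rGamma (deriv rGamma s) s :=
  (contDiff_rGamma.differentiable one_ne_zero s).hasDerivAt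

theorem rGamma_eq (s : ℝ) : rGamma s = s * rGamma (s + 1) := by
  rcases eq_or_ne s 0 with rfl | hs
  · simp [rGamma]
  · rw [rGamma, rGamma, Real.Gamma_add_one hs]
    field_simp

theorem deriv_rGamma_eq (s : ℝ) :
    deriv rGamma s = rGamma (s + 1) + s * deriv rGamma (s + 1) := by
  have h : HasDerivAt (fun s => s * rGamma (s + 1)) (1 * rGamma (s + 1) +
      s * deriv rGamma (s + 1)) s :=
    (hasDerivAt_id' s).mul ((hasDerivAt_rGamma (s + 1)).comp_add_const s 1)
  rw [← (funext rGamma_eq : rGamma = fun s => s * rGamma (s + 1))] at h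
  rw [h.deriv, one_mul]

theorem rGamma_neg_nat (n : ℕ) : rGamma (-n) = 0 := by
  rw [rGamma, Real.Gamma_neg_nat_eq_zero, inv_zero]

/-- The zeros of `1 / Γ` at the nonpositive integers are simple. -/
theorem deriv_rGamma_neg_nat_ne_zero (n : ℕ) : deriv rGamma (-n) ≠ 0 := by
  induction n with
  | zero => rw [deriv_rGamma_eq]; simp [rGamma]
  | succ n ih =>
    rw [deriv_rGamma_eq, show (-((n + 1 : ℕ) : ℝ)) + 1 = -n by push_cast; ring, rGamma_neg_nat,
      zero_add]
    exact mul_ne_zero (neg_ne_zero.2 (by positivity)) ih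

/-- On a half line `1 / Γ` is bounded and its derivative grows at most linearly. -/
theorem exists_rGamma_bound {N : ℝ} (hN : 0 ≤ N) :
    ∃ C : ℝ, 0 ≤ C ∧ ∀ (j : ℕ) (s : ℝ), -N ≤ s → s ≤ 2 + j →
    |rGamma s| ≤ C ∧ |deriv rGamma s| ≤ C * (1 + j) := by
  have hc1 := contDiff_rGamma.continuous
  have hc2 := contDiff_rGamma.continuous_deriv le_rfl
  obtain ⟨C₁, h1⟩ := isCompact_Icc.exists_bound_of_continuousOn (s := Set.Icc (-N) 2)
    hc1.continuousOn
  obtain ⟨C₂, h2⟩ := isCompact_Icc.exists_bound_of_continuousOn (s := Set.Icc (-N) 2)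
    hc2.continuousOn
  set C := max 0 (max C₁ C₂)
  have hC0 : 0 ≤ C := le_max_left _ _
  have hC1 : C₁ ≤ C := (le_max_left _ _).trans (le_max_right _ _)
  have hC2 : C₂ ≤ C := (le_max_right _ _).trans (le_max_right _ _)
  refine ⟨C, hC0, fun j => ?_⟩
  induction j with
  | zero =>
    intro s hs hs2
    have hm : s ∈ Set.Icc (-N) 2 := ⟨hs, by simpa using hs2⟩
    exact ⟨(h1 s hm).trans hC1, by simpa using (h2 s hm).trans hC2⟩
  | succ j ih =>
    intro s hs hs2
    have hj : (0 : ℝ) ≤ j := Nat.cast_nonneg j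
    push_cast at hs2 ⊢
    rcases le_or_gt s (2 + j) with hle | hgt
    · obtain ⟨ha, hb⟩ := ih s hs hle
      exact ⟨ha, hb.trans (by nlinarith)⟩
    · obtain ⟨ha, hb⟩ := ih (s - 1) (by linarith) (by linarith)
      have ht : 1 ≤ s - 1 := by linarith
      have e1 := rGamma_eq (s - 1)
      have e2 := deriv_rGamma_eq (s - 1)
      rw [sub_add_cancel] at e1 e2
      have h3 : |rGamma s| ≤ C := by
        rw [e1, abs_mul, abs_of_pos (one_pos.trans_le ht)] at ha
        exact (le_mul_of_one_le_left (abs_nonneg _) ht).trans ha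
      refine ⟨h3, ?_⟩
      have h4 : (s - 1) * |deriv rGamma s| ≤ C * (1 + j) + C := by
        rw [← abs_of_pos (one_pos.trans_le ht), ← abs_mul,
          show (s - 1) * deriv rGamma s = deriv rGamma (s - 1) - rGamma s by rw [e2]; ring]
        exact (abs_sub _ _).trans (add_le_add hb h3)
      calc |deriv rGamma s| ≤ (s - 1) * |deriv rGamma s| :=
            le_mul_of_one_le_left (abs_nonneg _) ht
        _ ≤ C * (1 + (j + 1)) := by linarith

/-! ### The Bessel series and its dependence on the order -/

/-- The coefficients of `∑ₖ (-1)ᵏ / (k! Γ(μ + k + 1)) zᵏ`. -/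
noncomputable def besselCoeff (μ : ℝ) (k : ℕ) : ℝ :=
  (-1) ^ k / k.factorial * rGamma (μ + k + 1)

/-- The derivatives of `besselCoeff μ k` with respect to the order `μ`. -/
noncomputable def besselCoeffDeriv (μ : ℝ) (k : ℕ) : ℝ :=
  (-1) ^ k / k.factorial * deriv rGamma (μ + k + 1)

theorem besselJ_eq (μ x : ℝ) :
    besselJ μ x = (x / 2) ^ μ * powerSum (besselCoeff μ) (x ^ 2 / 4) := by
  rw [besselJ, powerSum]
  congr 1
  refine tsum_congr fun k => ?_
  rw [besselCoeff, rGamma, pow_mul, show (x / 2) ^ 2 = x ^ 2 / 4 by ring]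
  field_simp

/-- Locally uniform bounds for the coefficients and their derivatives in the order. -/
theorem exists_besselCoeff_bound (μ₀ : ℝ) : ∃ A B : ℝ, ∀ μ ∈ Metric.ball μ₀ 1, ∀ k : ℕ,
    |besselCoeff μ k| ≤ A * B ^ k / k.factorial ∧
    |besselCoeffDeriv μ k| ≤ A * B ^ k / k.factorial := by
  obtain ⟨M, hM⟩ := exists_nat_ge |μ₀|
  obtain ⟨C, hC, hb⟩ := exists_rGamma_bound M.cast_nonneg
  refine ⟨C * (1 + M), 2, fun μ hμ k => ?_⟩
  rw [Metric.mem_ball, Real.dist_eq, abs_lt] at hμ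
  have hM' := abs_le.1 hM
  have hk : (0 : ℝ) ≤ k := Nat.cast_nonneg k
  obtain ⟨h1, h2⟩ := hb (k + M) (μ + k + 1) (by linarith [hM'.1]) (by push_cast; linarith [hM'.2])
  push_cast at h2
  have hM0 : (0 : ℝ) ≤ M := Nat.cast_nonneg M
  have hpow : (1 + k : ℝ) ≤ 2 ^ k := by
    have := (Nat.lt_two_pow_self (n := k))
    have : 1 + k ≤ 2 ^ k := by omega
    exact_mod_cast this
  have h3 : C * (1 + (k + M)) ≤ C * (1 + M) * 2 ^ k := by
    rw [mul_assoc]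
    refine mul_le_mul_of_nonneg_left ?_ hC
    nlinarith [mul_nonneg hM0 hk, mul_le_mul_of_nonneg_left hpow (by positivity : (0:ℝ) ≤ 1 + M)]
  have h4 : C ≤ C * (1 + (k + M)) := le_mul_of_one_le_right hC (by linarith)
  have hf : |(-1 : ℝ) ^ k / k.factorial| = 1 / k.factorial := by
    rw [abs_div, abs_pow, abs_neg, abs_one, one_pow, Nat.abs_cast]
  constructor
  · rw [besselCoeff, abs_mul, hf, one_div_mul_eq_div]
    gcongr
    exact (h1.trans h4).trans h3
  · rw [besselCoeffDeriv, abs_mul, hf, one_div_mul_eq_div]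
    gcongr
    exact h2.trans h3

theorem isEntireCoeff_besselCoeff (μ : ℝ) : IsEntireCoeff (besselCoeff μ) := by
  obtain ⟨A, B, h⟩ := exists_besselCoeff_bound μ
  exact .of_abs_le fun k => (h μ (Metric.mem_ball_self one_pos) k).1

theorem isEntireCoeff_besselCoeffDeriv (μ : ℝ) : IsEntireCoeff (besselCoeffDeriv μ) := by
  obtain ⟨A, B, h⟩ := exists_besselCoeff_bound μ
  exact .of_abs_le fun k => (h μ (Metric.mem_ball_self one_pos) k).2

theorem besselCoeff_succ (μ : ℝ) (k : ℕ) :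
    (k + 1) * (μ + k + 1) * besselCoeff μ (k + 1) + besselCoeff μ k = 0 := by
  rw [besselCoeff, besselCoeff, rGamma_eq (μ + k + 1), Nat.factorial_succ]
  have := k.factorial_ne_zero
  push_cast
  field_simp
  ring_nf

theorem besselCoeffDeriv_succ (μ : ℝ) (k : ℕ) :
    (k + 1) * (μ + k + 1) * besselCoeffDeriv μ (k + 1) + besselCoeffDeriv μ k +
      (k + 1) * besselCoeff μ (k + 1) = 0 := by
  rw [besselCoeff, besselCoeffDeriv, besselCoeffDeriv, deriv_rGamma_eq (μ + k + 1),
    Nat.factorial_succ]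
  have := k.factorial_ne_zero
  push_cast
  field_simp
  ring_nf

theorem hasDerivAt_powerSum_besselCoeff (μ z : ℝ) :
    HasDerivAt (fun μ => powerSum (besselCoeff μ) z) (powerSum (besselCoeffDeriv μ) z) μ := by
  obtain ⟨A, B, h⟩ := exists_besselCoeff_bound μ
  have hμ := Metric.mem_ball_self (x := μ) one_pos
  have hu : Summable fun k : ℕ => A * B ^ k / k.factorial * |z| ^ k := by
    refine ((Real.summable_pow_div_factorial (B * |z|)).mul_left A).congr fun k => ?_
    rw [mul_pow]; ring
  refine hasDerivAt_tsum_of_isPreconnected (g := fun k μ => besselCoeff μ k * z ^ k)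
    (g' := fun k μ => besselCoeffDeriv μ k * z ^ k) hu Metric.isOpen_ball
    (convex_ball μ 1).isPreconnected (fun k y _ => ?_) (fun k y hy => ?_) hμ
    ((isEntireCoeff_besselCoeff μ).summable z) hμ
  · refine HasDerivAt.mul_const (HasDerivAt.const_mul _ ?_) _
    have := (hasDerivAt_rGamma (y + (k + 1))).comp_add_const y ((k : ℝ) + 1)
    simpa only [add_assoc] using this
  · rw [norm_mul, norm_pow, Real.norm_eq_abs, Real.norm_eq_abs]
    gcongr
    exact (h y hy k).2

/-- The derivative of `J_μ(x)` with respect to the order `μ`. -/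
noncomputable def besselJDeriv (μ x : ℝ) : ℝ :=
  (x / 2) ^ μ * (powerSum (besselCoeffDeriv μ) (x ^ 2 / 4) +
    Real.log (x / 2) * powerSum (besselCoeff μ) (x ^ 2 / 4))

theorem hasDerivAt_besselJ_order (μ : ℝ) {x : ℝ} (hx : 0 < x) :
    HasDerivAt (fun μ => besselJ μ x) (besselJDeriv μ x) μ := by
  simp only [besselJ_eq]
  refine ((hasDerivAt_id' μ).const_rpow (half_pos hx)).mul
    (hasDerivAt_powerSum_besselCoeff μ (x ^ 2 / 4)) |>.congr_deriv ?_
  rw [besselJDeriv]; ring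

/-! ### Bessel's equation -/

/-- A Frobenius series `√x (x/2)^μ (C(x²/4) + log(x/2) E(x²/4))` solves the Liouville normal form
up to the term `(2 μ / x²) √x (x/2)^μ E(x²/4)`. -/
theorem exists_deriv_frobenius {μ : ℝ} {c e : ℕ → ℝ} (hc : IsEntireCoeff c) (he : IsEntireCoeff e)
    (hce : ∀ k : ℕ, (k + 1) * (μ + k + 1) * c (k + 1) + c k + (k + 1) * e (k + 1) = 0)
    (hee : ∀ k : ℕ, (k + 1) * (μ + k + 1) * e (k + 1) + e k = 0) :
    ∃ y' : ℝ → ℝ, ∀ x, 0 < x →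
      HasDerivAt (fun x => √x * ((x / 2) ^ μ *
        (powerSum c (x ^ 2 / 4) + Real.log (x / 2) * powerSum e (x ^ 2 / 4)))) (y' x) x ∧
      HasDerivAt y' (-((1 - (μ ^ 2 - 1 / 4) / x ^ 2) * (√x * ((x / 2) ^ μ *
        (powerSum c (x ^ 2 / 4) + Real.log (x / 2) * powerSum e (x ^ 2 / 4))))) +
        2 * μ / x ^ 2 * (√x * ((x / 2) ^ μ * powerSum e (x ^ 2 / 4)))) x := by
  set p : ℝ → ℝ := fun x => √x * (x / 2) ^ μ with hp
  have hpd : ∀ x, 0 < x → HasDerivAt p ((μ + 1 / 2) * p x / x) x := by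
    intro x hx
    have h2 := half_pos hx
    refine HasDerivAt.congr_deriv ((Real.hasDerivAt_sqrt hx.ne').mul
      (((hasDerivAt_id' x).div_const 2).rpow_const (p := μ) (Or.inl h2.ne'))) ?_
    have hs := Real.sq_sqrt hx.le
    have hs0 := Real.sqrt_pos.2 hx
    simp only [hp]
    rw [Real.rpow_sub_one h2.ne']
    set s := √x
    rw [← hs]
    field_simp
    ring
  have hz : ∀ x : ℝ, HasDerivAt (fun x : ℝ => x ^ 2 / 4) (x / 2) x := by
    intro x
    refine HasDerivAt.congr_deriv ((hasDerivAt_pow 2 x).div_const 4) ?_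
    norm_num; ring
  have hps : ∀ {c : ℕ → ℝ}, IsEntireCoeff c → ∀ x : ℝ,
      HasDerivAt (fun x : ℝ => powerSum c (x ^ 2 / 4))
        (powerSum (derivCoeff c) (x ^ 2 / 4) * (x / 2)) x := fun hc x =>
    HasDerivAt.comp (h := fun x : ℝ => x ^ 2 / 4) x (hc.hasDerivAt (x ^ 2 / 4)) (hz x)
  have hl : ∀ x : ℝ, 0 < x → HasDerivAt (fun x : ℝ => Real.log (x / 2)) (1 / x) x := by
    intro x hx
    refine HasDerivAt.congr_deriv (((hasDerivAt_id' x).div_const 2).log (half_pos hx).ne') ?_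
    have := hx.ne'
    field_simp
  set C := fun x : ℝ => powerSum c (x ^ 2 / 4)
  set C₁ := fun x : ℝ => powerSum (derivCoeff c) (x ^ 2 / 4)
  set C₂ := fun x : ℝ => powerSum (derivCoeff (derivCoeff c)) (x ^ 2 / 4)
  set E := fun x : ℝ => powerSum e (x ^ 2 / 4)
  set E₁ := fun x : ℝ => powerSum (derivCoeff e) (x ^ 2 / 4)
  set E₂ := fun x : ℝ => powerSum (derivCoeff (derivCoeff e)) (x ^ 2 / 4)
  set l := fun x : ℝ => Real.log (x / 2)
  have hC : ∀ x, HasDerivAt C (C₁ x * (x / 2)) x := hps hc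
  have hC₁ : ∀ x, HasDerivAt C₁ (C₂ x * (x / 2)) x := hps hc.derivCoeff
  have hE : ∀ x, HasDerivAt E (E₁ x * (x / 2)) x := hps he
  have hE₁ : ∀ x, HasDerivAt E₁ (E₂ x * (x / 2)) x := hps he.derivCoeff
  have odeC : ∀ x, x ^ 2 / 4 * C₂ x + (μ + 1) * C₁ x + C x + E₁ x = 0 := fun x =>
    powerSum_ode hc he hce _
  have odeE : ∀ x, x ^ 2 / 4 * E₂ x + (μ + 1) * E₁ x + E x = 0 := by
    intro x
    have h0 : IsEntireCoeff (fun _ => (0 : ℝ)) := fun R _ => by simp [summable_zero]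
    have := powerSum_ode (e := fun _ => 0) he h0 (by simpa using hee) (x ^ 2 / 4)
    have h1 : powerSum (derivCoeff fun _ => 0) (x ^ 2 / 4) = 0 := by simp [powerSum, derivCoeff]
    rw [h1, add_zero] at this
    exact this
  refine ⟨fun x => (μ + 1 / 2) * p x / x * (C x + l x * E x) +
    p x * (C₁ x * (x / 2) + (1 / x * E x + l x * (E₁ x * (x / 2)))), fun x hx => ⟨?_, ?_⟩⟩
  · have := (hpd x hx).mul ((hC x).add ((hl x hx).mul (hE x)))
    refine this.congr_of_eventuallyEq (Filter.Eventually.of_forall fun t => ?_)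
    simp only [hp, C, E, l, Pi.mul_apply, Pi.add_apply]
    ring
  · have hx2 : HasDerivAt (fun x : ℝ => x / 2) (1 / 2) x := (hasDerivAt_id' x).div_const 2
    have hinv : HasDerivAt (fun x : ℝ => 1 / x) (-(x ^ 2)⁻¹) x := by
      simpa using hasDerivAt_inv hx.ne'
    refine HasDerivAt.congr_deriv (((((hpd x hx).const_mul (μ + 1 / 2)).div (hasDerivAt_id' x)
      hx.ne').mul ((hC x).add ((hl x hx).mul (hE x)))).add ((hpd x hx).mul
      (((hC₁ x).mul hx2).add ((hinv.mul (hE x)).add ((hl x hx).mul ((hE₁ x).mul hx2)))))) ?_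
    have e1 := odeC x
    have e2 := odeE x
    have e3 : √x * ((x / 2) ^ μ * (C x + l x * E x)) = p x * (C x + l x * E x) := by
      simp only [hp]; ring
    have e4 : √x * ((x / 2) ^ μ * E x) = p x * E x := by
      simp only [hp]; ring
    simp only [Pi.mul_apply, Pi.add_apply, Pi.div_apply]
    rw [e3, e4]
    have := hx.ne'
    field_simp
    linear_combination (16 * x ^ 2 * p x) * e1 + (16 * x ^ 2 * p x * l x) * e2

/-- `√x J_μ(x)` solves the Liouville normal form. -/
theorem exists_isLiouvilleSol_besselJ (μ : ℝ) :
    ∃ y', IsLiouvilleSol (μ ^ 2 - 1 / 4) (fun x => √x * besselJ μ x) y' := by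
  have h0 : IsEntireCoeff (fun _ => (0 : ℝ)) := fun R _ => by simp [summable_zero]
  obtain ⟨y', hy⟩ := exists_deriv_frobenius (isEntireCoeff_besselCoeff μ) h0
    (by simpa using besselCoeff_succ μ) (by simp)
  have h1 : ∀ z, powerSum (fun _ => 0) z = 0 := by simp [powerSum]
  simp only [h1, mul_zero, add_zero, ← besselJ_eq] at hy
  exact ⟨y', hy⟩

/-- The order derivative `√x ∂J_μ(x)/∂μ` solves the Liouville normal form with the right-hand side
`(2 μ / x²) √x J_μ(x)`, as differentiating the equation in `μ` predicts. -/
theorem exists_deriv_besselJDeriv (μ : ℝ) :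
    ∃ y' : ℝ → ℝ, ∀ x, 0 < x → HasDerivAt (fun x => √x * besselJDeriv μ x) (y' x) x ∧
      HasDerivAt y' (-((1 - (μ ^ 2 - 1 / 4) / x ^ 2) * (√x * besselJDeriv μ x)) +
        2 * μ / x ^ 2 * (√x * besselJ μ x)) x := by
  obtain ⟨y', hy⟩ := exists_deriv_frobenius (isEntireCoeff_besselCoeffDeriv μ)
    (isEntireCoeff_besselCoeff μ) (besselCoeffDeriv_succ μ) (besselCoeff_succ μ)
  simp only [← besselJ_eq] at hy
  exact ⟨y', hy⟩

theorem powerSum_besselCoeff_neg_nat (n : ℕ) (z : ℝ) :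
    powerSum (besselCoeff (-n)) z = (-1) ^ n * z ^ n * powerSum (besselCoeff n) z := by
  have hs := (isEntireCoeff_besselCoeff (-n)).summable z
  rw [powerSum, ← hs.sum_add_tsum_nat_add n, Finset.sum_eq_zero, zero_add, powerSum,
    ← tsum_mul_left]
  · refine tsum_congr fun k => ?_
    rw [besselCoeff, besselCoeff, rGamma, rGamma,
      show -(n : ℝ) + ((k + n : ℕ) : ℝ) + 1 = k + 1 by push_cast; ring,
      Real.Gamma_nat_eq_factorial,
      show (n : ℝ) + (k : ℝ) + 1 = ((k + n : ℕ) : ℝ) + 1 by push_cast; ring,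
      Real.Gamma_nat_eq_factorial, pow_add, pow_add]
    field_simp
  · intro k hk
    rw [Finset.mem_range] at hk
    obtain ⟨m, rfl⟩ := Nat.exists_eq_add_of_lt hk
    rw [besselCoeff, show -((k + m + 1 : ℕ) : ℝ) + k + 1 = -m by push_cast; ring, rGamma_neg_nat,
      mul_zero, zero_mul]

theorem besselJ_neg_nat (n : ℕ) {x : ℝ} (hx : 0 < x) :
    besselJ (-n) x = (-1) ^ n * besselJ n x := by
  have h2 := half_pos hx
  rw [besselJ_eq, besselJ_eq, powerSum_besselCoeff_neg_nat, Real.rpow_neg h2.le, Real.rpow_natCast,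
    show x ^ 2 / 4 = (x / 2) ^ 2 by ring, ← pow_mul (x / 2) 2 n, mul_comm 2 n, pow_mul]
  have ht : (x / 2) ^ n ≠ 0 := (pow_pos h2 n).ne'
  generalize (x / 2) ^ n = t at ht
  field_simp

/-- The limit defining `Y_n` exists, and L'Hôpital's rule evaluates it. -/
theorem besselY_nat (n : ℕ) {x : ℝ} (hx : 0 < x) :
    besselY n x = ((-1) ^ n * besselJDeriv n x + besselJDeriv (-n) x) / (Real.pi * (-1) ^ n) := by
  have hsin : Real.sin (n * Real.pi) = 0 := Real.sin_nat_mul_pi n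
  have hcos : Real.cos (n * Real.pi) = (-1) ^ n := Real.cos_nat_mul_pi n
  rw [besselY, if_pos hsin]
  refine Filter.Tendsto.limUnder_eq ?_
  have hlin : HasDerivAt (fun μ : ℝ => μ * Real.pi) Real.pi (n : ℝ) := by
    simpa using (hasDerivAt_id' (n : ℝ)).mul_const Real.pi
  have hnum : HasDerivAt (fun μ : ℝ => besselJ μ x * Real.cos (μ * Real.pi) - besselJ (-μ) x)
      ((-1) ^ n * besselJDeriv n x + besselJDeriv (-n) x) (n : ℝ) := by
    refine HasDerivAt.congr_deriv (((hasDerivAt_besselJ_order n hx).mul hlin.cos).sub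
      (HasDerivAt.comp (h := fun μ : ℝ => -μ) (n : ℝ) (hasDerivAt_besselJ_order (-n) hx)
        (hasDerivAt_neg' (n : ℝ)))) ?_
    rw [hsin, hcos]; ring
  have hden : HasDerivAt (fun μ : ℝ => Real.sin (μ * Real.pi)) (Real.pi * (-1) ^ n) (n : ℝ) := by
    refine hlin.sin.congr_deriv ?_
    rw [hcos]; ring
  have h := (hasDerivAt_iff_tendsto_slope.1 hnum).div (hasDerivAt_iff_tendsto_slope.1 hden)
    (mul_ne_zero Real.pi_ne_zero (pow_ne_zero n (by norm_num)))
  refine h.congr' ?_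
  filter_upwards [self_mem_nhdsWithin] with μ hμ
  have hμ' : μ - n ≠ 0 := sub_ne_zero.2 hμ
  simp only [Pi.div_apply, slope_def_field, hsin, hcos, besselJ_neg_nat n hx, besselYQuot]
  rw [div_div_div_cancel_right₀ hμ']
  ring_nf

/-! ### Behaviour at the origin and linear independence -/

theorem tendsto_half_nhdsGT_zero :
    Filter.Tendsto (fun x : ℝ => x / 2) (nhdsWithin 0 (Set.Ioi 0)) (nhdsWithin 0 (Set.Ioi 0)) := by
  refine tendsto_nhdsWithin_of_tendsto_nhds_of_eventually_within _ ?_ ?_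
  · have : Filter.Tendsto (fun x : ℝ => x / 2) (nhds 0) (nhds (0 / 2)) :=
      (continuous_id.div_const 2).tendsto 0
    rw [zero_div] at this
    exact this.mono_left nhdsWithin_le_nhds
  · filter_upwards [self_mem_nhdsWithin] with x hx using half_pos (Set.mem_Ioi.1 hx)

theorem tendsto_half_rpow {ν : ℝ} (hν : 0 < ν) :
    Filter.Tendsto (fun x : ℝ => (x / 2) ^ ν) (nhdsWithin 0 (Set.Ioi 0)) (nhds 0) := by
  have := (Real.continuous_rpow_const hν.le).tendsto 0
  rw [Real.zero_rpow hν.ne'] at this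
  exact (this.mono_left nhdsWithin_le_nhds).comp tendsto_half_nhdsGT_zero

theorem tendsto_log_half_mul_rpow {ν : ℝ} (hν : 0 < ν) :
    Filter.Tendsto (fun x : ℝ => Real.log (x / 2) * (x / 2) ^ ν)
      (nhdsWithin 0 (Set.Ioi 0)) (nhds 0) :=
  (tendsto_log_mul_rpow_nhdsGT_zero hν).comp tendsto_half_nhdsGT_zero

theorem tendsto_powerSum {c : ℕ → ℝ} (hc : IsEntireCoeff c) :
    Filter.Tendsto (fun x : ℝ => powerSum c (x ^ 2 / 4)) (nhdsWithin 0 (Set.Ioi 0))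
      (nhds (c 0)) := by
  have h : Continuous fun x : ℝ => powerSum c (x ^ 2 / 4) := hc.continuous.comp (by fun_prop)
  have := h.tendsto 0
  simp only [ne_eq, OfNat.ofNat_ne_zero, not_false_eq_true, zero_pow, zero_div,
    powerSum_zero] at this
  exact this.mono_left nhdsWithin_le_nhds

theorem exists_nat_of_sin_mul_pi_eq_zero {ν : ℝ} (hν : 0 < ν) (h : Real.sin (ν * Real.pi) = 0) :
    ∃ n : ℕ, (n : ℝ) = ν := by
  obtain ⟨k, hk⟩ := Real.sin_eq_zero_iff.1 h
  have hk' : (k : ℝ) = ν := mul_right_cancel₀ Real.pi_ne_zero hk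
  have hk0 : 0 ≤ k := by
    have : (0 : ℝ) < k := hk' ▸ hν
    exact_mod_cast this.le
  lift k to ℕ using hk0
  exact ⟨k, by exact_mod_cast hk'⟩

/-- `√x Y_ν(x)` solves the Liouville normal form. -/
theorem exists_isLiouvilleSol_besselY {ν : ℝ} (hν : 0 < ν) :
    ∃ y', IsLiouvilleSol (ν ^ 2 - 1 / 4) (fun x => √x * besselY ν x) y' := by
  by_cases hs : Real.sin (ν * Real.pi) = 0
  · obtain ⟨n, rfl⟩ := exists_nat_of_sin_mul_pi_eq_zero hν hs
    obtain ⟨f', hf⟩ := exists_deriv_besselJDeriv n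
    obtain ⟨g', hg⟩ := exists_deriv_besselJDeriv (-n)
    refine ⟨fun x => ((-1) ^ n * f' x + g' x) / (Real.pi * (-1) ^ n), fun x hx => ⟨?_, ?_⟩⟩
    · refine ((((hf x hx).1.const_mul _).add (hg x hx).1).div_const _).congr_of_eventuallyEq ?_
      filter_upwards [lt_mem_nhds hx] with t ht
      rw [besselY_nat n ht]
      simp only [Pi.add_apply]
      ring
    · refine HasDerivAt.congr_deriv
        ((((hf x hx).2.const_mul _).add (hg x hx).2).div_const _) ?_
      beta_reduce
      rw [besselJ_neg_nat n hx, besselY_nat n hx]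
      ring
  · obtain ⟨f', hf⟩ := exists_isLiouvilleSol_besselJ ν
    obtain ⟨g', hg⟩ := exists_isLiouvilleSol_besselJ (-ν)
    rw [neg_sq] at hg
    have h := hf.linear_comb hg (Real.cos (ν * Real.pi) / Real.sin (ν * Real.pi))
      (-1 / Real.sin (ν * Real.pi))
    have he : (fun x => √x * besselY ν x) = fun x =>
        Real.cos (ν * Real.pi) / Real.sin (ν * Real.pi) * (√x * besselJ ν x) +
          -1 / Real.sin (ν * Real.pi) * (√x * besselJ (-ν) x) := by
      funext x
      rw [besselY, if_neg hs, besselYQuot]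
      ring
    rw [he]
    exact ⟨_, h⟩

/-- The singular behaviour of `Y_ν` at the origin: `(x/2)^ν Y_ν(x)` has a nonzero limit. -/
theorem exists_tendsto_besselY {ν : ℝ} (hν : 0 < ν) :
    ∃ l : ℝ, l ≠ 0 ∧ Filter.Tendsto (fun x => (x / 2) ^ ν * besselY ν x)
      (nhdsWithin 0 (Set.Ioi 0)) (nhds l) := by
  have hr := tendsto_half_rpow hν
  have hlog := tendsto_log_half_mul_rpow hν
  have hP := tendsto_powerSum (isEntireCoeff_besselCoeff ν)
  have hPn := tendsto_powerSum (isEntireCoeff_besselCoeff (-ν))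
  by_cases hs : Real.sin (ν * Real.pi) = 0
  · have hT := tendsto_powerSum (isEntireCoeff_besselCoeffDeriv ν)
    have hTn := tendsto_powerSum (isEntireCoeff_besselCoeffDeriv (-ν))
    obtain ⟨n, rfl⟩ := exists_nat_of_sin_mul_pi_eq_zero hν hs
    have hn : n ≠ 0 := by rintro rfl; simp at hν
    obtain ⟨m, rfl⟩ := Nat.exists_eq_succ_of_ne_zero hn
    set n := m + 1
    have hε : Real.pi * (-1) ^ n ≠ 0 := mul_ne_zero Real.pi_ne_zero (pow_ne_zero n (by norm_num))
    refine ⟨besselCoeffDeriv (-n) 0 / (Real.pi * (-1) ^ n), div_ne_zero ?_ hε, ?_⟩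
    · rw [besselCoeffDeriv, show -(n : ℝ) + (0 : ℕ) + 1 = -m by simp [n]]
      simpa using deriv_rGamma_neg_nat_ne_zero m
    · have hlim := ((((hr.mul hr).mul hT).add ((hr.mul hlog).mul hP)).const_mul ((-1) ^ n) |>.add
        (hTn.add (((hlog.mul hr).mul hP).const_mul ((-1) ^ n)))).div_const (Real.pi * (-1) ^ n)
      simp only [zero_mul, mul_zero, add_zero, zero_add] at hlim
      refine hlim.congr' ?_
      filter_upwards [self_mem_nhdsWithin] with x hx
      have hx2 : 0 < x / 2 := half_pos hx
      have e : (x / 2) ^ (n : ℝ) * (x / 2) ^ (-(n : ℝ)) = 1 := by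
        rw [← Real.rpow_add hx2, add_neg_cancel, Real.rpow_zero]
      have ez : (x ^ 2 / 4) ^ n = (x / 2) ^ (n : ℝ) * (x / 2) ^ (n : ℝ) := by
        rw [Real.rpow_natCast, ← mul_pow]; ring
      rw [besselY_nat n hx, besselJDeriv, besselJDeriv, powerSum_besselCoeff_neg_nat, ez,
        ← mul_div_assoc]
      congr 1
      linear_combination (-(powerSum (besselCoeffDeriv (-n)) (x ^ 2 / 4) + Real.log (x / 2) *
        ((-1) ^ n * ((x / 2) ^ (n : ℝ) * (x / 2) ^ (n : ℝ)) *
          powerSum (besselCoeff n) (x ^ 2 / 4)))) * e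
  · refine ⟨-besselCoeff (-ν) 0 / Real.sin (ν * Real.pi), div_ne_zero (neg_ne_zero.2 ?_) hs, ?_⟩
    · have : Real.Gamma (-ν + (0 : ℕ) + 1) ≠ 0 := by
        refine Real.Gamma_ne_zero fun m hm => hs ?_
        have : ν = ((m + 1 : ℕ) : ℝ) := by push_cast at hm ⊢; linarith
        rw [this, Real.sin_nat_mul_pi]
      rw [besselCoeff, rGamma]
      simpa using this
    · have hlim := ((((hr.mul hr).mul hP).const_mul (Real.cos (ν * Real.pi))).sub hPn).div_const
        (Real.sin (ν * Real.pi))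
      simp only [zero_mul, mul_zero, zero_sub] at hlim
      refine hlim.congr' ?_
      filter_upwards [self_mem_nhdsWithin] with x hx
      have hx2 : 0 < x / 2 := half_pos hx
      have e : (x / 2) ^ ν * (x / 2) ^ (-ν) = 1 := by
        rw [← Real.rpow_add hx2, add_neg_cancel, Real.rpow_zero]
      rw [besselY, if_neg hs, besselYQuot, besselJ_eq, besselJ_eq, ← mul_div_assoc]
      congr 1
      linear_combination powerSum (besselCoeff (-ν)) (x ^ 2 / 4) * e

/-- `√x J_ν` and `√x Y_ν` are linearly independent: a vanishing Wronskian would make `Y_ν` a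
multiple of `J_ν` near the origin, although only `Y_ν` is singular there. -/
theorem wronskian_bessel_ne_zero {ν : ℝ} (hν : 0 < ν) {f' g' : ℝ → ℝ}
    (hf : IsLiouvilleSol (ν ^ 2 - 1 / 4) (fun x => √x * besselJ ν x) f')
    (hg : IsLiouvilleSol (ν ^ 2 - 1 / 4) (fun x => √x * besselY ν x) g') {X : ℝ} (hX : 0 < X) :
    √X * besselJ ν X * g' X - f' X * (√X * besselY ν X) ≠ 0 := by
  intro hW
  have hP := tendsto_powerSum (isEntireCoeff_besselCoeff ν)
  have hP0 : 0 < besselCoeff ν 0 := by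
    have : 0 < Real.Gamma (ν + (0 : ℕ) + 1) := Real.Gamma_pos_of_pos (by simp; linarith)
    rw [besselCoeff, rGamma]
    positivity
  obtain ⟨δ, hδ, hJ⟩ : ∃ δ : ℝ, 0 < δ ∧ ∀ x ∈ Set.Ioo 0 δ, √x * besselJ ν x ≠ 0 := by
    obtain ⟨δ, hδ, h⟩ := mem_nhdsGT_iff_exists_Ioo_subset.1 (hP.eventually_ne hP0.ne')
    refine ⟨δ, hδ, fun x hx => ?_⟩
    rw [besselJ_eq]
    exact mul_ne_zero (Real.sqrt_pos.2 hx.1).ne'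
      (mul_ne_zero (Real.rpow_pos_of_pos (half_pos hx.1) ν).ne' (h hx))
  have hd : ∀ x ∈ Set.Ioo 0 δ,
      HasDerivAt (fun x => √x * besselY ν x / (√x * besselJ ν x)) 0 x := by
    intro x hx
    refine HasDerivAt.congr_deriv ((hg x hx.1).1.div (hf x hx.1).1 (hJ x hx)) ?_
    have h0 := (hf.wronskian_eq hg hx.1 hX).trans hW
    rw [div_eq_zero_iff]
    left
    linear_combination h0
  obtain ⟨k, hk⟩ : ∃ k, ∀ x ∈ Set.Ioo 0 δ, √x * besselY ν x / (√x * besselJ ν x) = k :=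
    isOpen_Ioo.exists_is_const_of_deriv_eq_zero isPreconnected_Ioo
      (fun x hx => (hd x hx).differentiableAt.differentiableWithinAt) (fun x hx => (hd x hx).deriv)
  obtain ⟨l, hl, hY⟩ := exists_tendsto_besselY hν
  have hr := tendsto_half_rpow hν
  have hlim := ((hr.mul hr).mul hP).const_mul k
  simp only [zero_mul, mul_zero] at hlim
  refine hl (tendsto_nhds_unique hY (hlim.congr' ?_))
  filter_upwards [Ioo_mem_nhdsGT hδ] with x hx
  have h1 := hk x hx
  rw [div_eq_iff (hJ x hx)] at h1
  have hs := (Real.sqrt_pos.2 hx.1).ne'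
  have h2 : besselY ν x = k * besselJ ν x := mul_left_cancel₀ hs (by linear_combination h1)
  rw [h2, besselJ_eq]
  ring

/-! ### Zeros of the cross product -/

/-- The positive zeros of the cross product are the zeros of the corresponding expression in any
normalised unit pair. -/
theorem exists_isUnitPair_cross {ν : ℝ} (hν : 0 < ν) {b X : ℝ} (hb : 0 < b) (hX : 0 < X) :
    ∃ U U' V V' : ℝ → ℝ, IsUnitPair (ν ^ 2 - 1 / 4) U U' V V' ∧
      U X = 1 ∧ U' X = 0 ∧ V X = 0 ∧ V' X = 1 ∧
      ∀ r, 0 < r → (besselCross b ν r 1 = 0 ↔ U r * V (r * b) - U (r * b) * V r = 0) := by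
  obtain ⟨f', hf⟩ := exists_isLiouvilleSol_besselJ ν
  obtain ⟨g', hg⟩ := exists_isLiouvilleSol_besselY hν
  obtain ⟨U, U', V, V', h, h1, h2, h3, h4, hc⟩ := IsUnitPair.exists_normalized hf hg hX
    (wronskian_bessel_ne_zero hν hf hg hX)
  refine ⟨U, U', V, V', h, h1, h2, h3, h4, fun r hr => ?_⟩
  rw [← hc r (r * b), besselCross, mul_one,
    show √r * besselJ ν r * (√(r * b) * besselY ν (r * b)) -
      √(r * b) * besselJ ν (r * b) * (√r * besselY ν r) = √r * √(r * b) *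
      (besselJ ν r * besselY ν (r * b) - besselJ ν (r * b) * besselY ν r) by ring,
    mul_eq_zero, or_iff_right]
  exact (mul_pos (Real.sqrt_pos.2 hr) (Real.sqrt_pos.2 (mul_pos hr hb))).ne'

/-- Any two positive zeros are at least `π / b` apart. -/
theorem pi_div_le_sub_of_besselCross_eq_zero {b ν : ℝ} (hb : 1 < b) (hν : 1 / 2 ≤ ν) {r₁ r₂ : ℝ}
    (hr₁ : 0 < r₁) (hr : r₁ < r₂) (hz₁ : besselCross b ν r₁ 1 = 0)
    (hz₂ : besselCross b ν r₂ 1 = 0) : Real.pi / b ≤ r₂ - r₁ := by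
  have hb0 := one_pos.trans hb
  have hr₂ := hr₁.trans hr
  obtain ⟨U, U', V, V', h, h1, h2, h3, h4, hc⟩ :=
    exists_isUnitPair_cross (by linarith : 0 < ν) hb0 (mul_pos hr₂ hb0)
  rw [div_le_iff₀' hb0]
  exact h.pi_le_of_cross_eq_zero (by nlinarith) hb hr₁ hr h1 h2 h3 h4 ((hc r₁ hr₁).1 hz₁)
    ((hc r₂ hr₂).1 hz₂)

theorem exists_isPositiveZeroSeq {b ν : ℝ} (hb : 1 < b) (hν : 1 / 2 ≤ ν) :
    ∃ ρ : ℕ → ℝ, IsPositiveZeroSeq b ν ρ := by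
  have hb0 := one_pos.trans hb
  obtain ⟨f, hf, hrange⟩ := exists_strictMono_range_of_separated
    (Z := {r : ℝ | 0 < r ∧ besselCross b ν r 1 = 0}) (div_pos Real.pi_pos hb0)
    (fun z hz => hz.1)
    (fun y hy z hz hyz => pi_div_le_sub_of_besselCross_eq_zero hb hν hy.1 hyz hy.2 hz.2)
    (fun N => by
      obtain ⟨U, U', V, V', h, h1, h2, h3, h4, hc⟩ :=
        exists_isUnitPair_cross (by linarith : 0 < ν) hb0 one_pos
      obtain ⟨r, hr, hN, hz⟩ := h.exists_cross_eq_zero (by nlinarith) h1 h3 hb N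
      exact ⟨r, ⟨hr, (hc r hr).2 hz⟩, hN⟩)
  refine ⟨fun m => f (m - 1), fun m hm n hn hmn => hf ?_, ?_⟩
  · simp only [Set.mem_Ici] at hm hn
    omega
  · rw [← hrange]
    ext r
    constructor
    · rintro ⟨m, _, rfl⟩
      exact ⟨m - 1, rfl⟩
    · rintro ⟨m, rfl⟩
      exact ⟨m + 1, by simp, by simp⟩

theorem theorem2 (b : ℝ) (hb : 1 < b) (ν : ℝ) (hν : 1 / 2 ≤ ν) :
    (∃ ρ : ℕ → ℝ, IsPositiveZeroSeq b ν ρ) ∧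
      ∀ ρ : ℕ → ℝ, IsPositiveZeroSeq b ν ρ →
        ∀ m : ℕ, 2 ≤ m → Real.pi / (2 * b - 1) < ρ (m + 1) - ρ m := by
  refine ⟨exists_isPositiveZeroSeq hb hν, fun ρ hρ m hm => ?_⟩
  have hm1 : m ∈ Set.Ici 1 := by simp only [Set.mem_Ici]; omega
  have hm2 : m + 1 ∈ Set.Ici 1 := by simp
  have hz : ∀ k ∈ Set.Ici 1, 0 < ρ k ∧ besselCross b ν (ρ k) 1 = 0 := fun k hk =>
    hρ.2.subset (Set.mem_image_of_mem ρ hk)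
  refine lt_of_lt_of_le ?_ (pi_div_le_sub_of_besselCross_eq_zero hb hν (hz m hm1).1
    (hρ.1 hm1 hm2 m.lt_succ_self) (hz m hm1).2 (hz _ hm2).2)
  exact div_lt_div_of_pos_left Real.pi_pos (by linarith) (by linarith)
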